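/- Let $\Sigma^+=\{0,1\}^{\mathbb N}$, $\mathbb N=\{1,2,\dots\}$, be the space of one-sided binary sequences, and let $\sigma\colon\Sigma^+\to\Sigma^+$, $\sigma(\{w_i\}_{i\in\mathbb N})=\{w_{i+1}\}_{i\in\mathbb N}$, be the left shift. Let $\theta\in(0,1/4)$ and let $\boldsymbol a=\{a_n\}_{n\ge 0}$ be a strictly decreasing sequence of positive numbers with $$\frac{a_{n+1}}{a_n}=O(\theta^n)\qquad\text{as } n\to+\infty$$ (in particular $a_n\to0$). Let $d_{\boldsymbol a}$ be the metric on $\Sigma^+$ given by $d_{\boldsymbol a}(w,z)=a_m$ for $w\ne z$, where $m$ is the smallest positive integer with $w_m\ne z_m$, and $d_{\boldsymbol a}(z,z)=0$. Let $\operatorname{Lip}(\Sigma^+,d_{\boldsymbol a})$ be the Banach space of real-valued functions that are Lipschitz with respect to $d_{\boldsymbol a}$, with the norm $$\|f\|_{\operatorname{Lip}}=\sup_x|f(x)|+\sup_{x\ne y}\frac{|f(x)-f(y)|}{d_{\boldsymbol a}(x,y)}.$$ For a continuous $f\colon\Sigma^+\to\mathbb R$, a $\sigma$-invariant Borel probability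 measure $\mu$ is called $f$-maximizing if $\int f\,d\nu\le\int f\,d\mu$ for every $\sigma$-invariant Borel probability measure $\nu$. Let $\mathscr{PU}(\sigma)$ be the set of continuous functions $f\colon\Sigma^+\to\mathbb R$ that have a unique $f$-maximizing measure and for which this measure is supported on a periodic orbit of $\sigma$. Let $\operatorname{Lock}_\sigma(\Sigma^+,d_{\boldsymbol a})$ be the set of $f\in\operatorname{Lip}(\Sigma^+,d_{\boldsymbol a})$ that have a unique maximizing measure $\nu$, such that $\nu$ is supported on a periodic orbit of $\sigma$ and $\nu$ is the unique maximizing measure of every $g\in\operatorname{Lip}(\Sigma^+,d_{\boldsymbol a})$ sufficiently close to $f$ in $\|\cdot\|_{\operatorname{Lip}}$. A Borel subset $B$ of a Banach space $V$ is called shy if there is a compactly supported Borel probability measure $\mu$ on $V$ with $\mu(B+v)=0$ for every $v\in V$; a subset $S\subseteq V$ is called prevalent (in the sense of Hunt--Sauer--Yorke) if $V\setminus S$ is contained in a shy Borel subset of $V$. Then $\mathscr{PU}(\sigma)\cap\operatorname{Lip}(\Sigma^+,d_{\boldsymbol a})$ is a prevalent set in $\operatorname{Lip}(\Sigma^+,d_{\boldsymbol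 a})$. Moreover, $\operatorname{Lock}_\sigma(\Sigma^+,d_{\boldsymbol a})$ is a prevalent set in $\operatorname{Lip}(\Sigma^+,d_{\boldsymbol a})$. -/

import Mathlib

open Set Filter Topology MeasureTheory

noncomputable section

/-! ### Prevalence -/

section Prevalence

variable {V : Type*} [AddCommGroup V] [TopologicalSpace V] [MeasurableSpace V]

/-- The measure `μ` is transverse to `B`: every translate of `B` is `μ`-null. -/
def IsTransverse (μ : Measure V) (B : Set V) : Prop :=
  ∀ v : V, μ ((fun x => x + v) '' B) = 0

/-- A Borel set is shy if some compactly supported Borel probability measure is transverse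
to it. (Used with the Borel σ-algebra on `V`.) -/
def IsShyBorel (B : Set V) : Prop :=
  MeasurableSet B ∧
    ∃ μ : Measure V, IsProbabilityMeasure μ ∧ (∃ K : Set V, IsCompact K ∧ μ Kᶜ = 0) ∧
      IsTransverse μ B

/-- A set is prevalent if its complement is contained in a shy Borel set. -/
def IsPrevalent (S : Set V) : Prop :=
  ∃ B : Set V, IsShyBorel B ∧ Sᶜ ⊆ B

end Prevalence

/-! ### Ergodic optimization -/

section Ergodic

variable {X : Type*} [MeasurableSpace X]

/-- `μ` is a `T`-invariant probability measure. -/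
def IsInvariantProb (T : X → X) (μ : Measure X) : Prop :=
  IsProbabilityMeasure μ ∧ MeasurePreserving T μ μ

/-- `μ` is an `f`-maximizing measure. -/
def IsMaximizing (T : X → X) (f : X → ℝ) (μ : Measure X) : Prop :=
  IsInvariantProb T μ ∧ ∀ ν : Measure X, IsInvariantProb T ν → ∫ x, f x ∂ν ≤ ∫ x, f x ∂μ

/-- `μ` is the unique `f`-maximizing measure. -/
def IsUniqueMaximizing (T : X → X) (f : X → ℝ) (μ : Measure X) : Prop :=
  IsMaximizing T f μ ∧ ∀ ν : Measure X, IsMaximizing T f ν → ν = μ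

/-- `μ` is supported on a periodic orbit of `T`. -/
def IsSupportedOnPeriodicOrbit (T : X → X) (μ : Measure X) : Prop :=
  ∃ x ∈ Function.periodicPts T, μ (range fun n : ℕ => T^[n] x)ᶜ = 0

/-- The set of continuous functions that have a unique maximizing measure, this measure being
supported on a periodic orbit. -/
def PU [TopologicalSpace X] (T : X → X) : Set C(X, ℝ) :=
  {f | ∃ μ : Measure X, IsUniqueMaximizing T f μ ∧ IsSupportedOnPeriodicOrbit T μ}

end Ergodic

/-! ### The Banach space of Lipschitz functions on a compact metric space -/

section Lip

/-- The vector space of real-valued Lipschitz functions. -/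
def lipSubmodule (X : Type*) [MetricSpace X] : Submodule ℝ (X → ℝ) where
  carrier := {f | ∃ K, LipschitzWith K f}
  zero_mem' := ⟨0, LipschitzWith.const 0⟩
  add_mem' := by
    rintro f g ⟨K, hf⟩ ⟨L, hg⟩
    exact ⟨K + L, hf.add hg⟩
  smul_mem' := by
    rintro c f ⟨K, hf⟩
    exact ⟨‖c‖₊ * K, (lipschitzWith_smul c).comp hf⟩

/-- The space `Lip(X, d)`; it carries the Lipschitz norm below. -/
def Lip (X : Type*) [MetricSpace X] : Type _ := lipSubmodule X

namespace Lip

variable {X : Type*} [MetricSpace X]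

instance : AddCommGroup (Lip X) := inferInstanceAs (AddCommGroup (lipSubmodule X))

instance : Module ℝ (Lip X) := inferInstanceAs (Module ℝ (lipSubmodule X))

instance : CoeFun (Lip X) (fun _ => X → ℝ) := ⟨fun f => f.1⟩

theorem lipschitz (f : Lip X) : ∃ K, LipschitzWith K f := f.2

/-- A Lipschitz function as a continuous function. -/
def toContinuousMap (f : Lip X) : C(X, ℝ) :=
  ⟨f, f.lipschitz.choose_spec.continuous⟩

/-- The sup-norm. -/
def supNorm (f : Lip X) : ℝ := ⨆ x : X, |f x|

/-- The minimal Lipschitz constant, as the supremum of the difference quotients. (The diagonal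
contributes the value `0 / 0 = 0` only.) -/
def lipConst (f : Lip X) : ℝ := ⨆ p : X × X, |f p.1 - f p.2| / dist p.1 p.2

instance : Norm (Lip X) := ⟨fun f => supNorm f + lipConst f⟩

theorem norm_def (f : Lip X) : ‖f‖ = supNorm f + lipConst f := rfl

theorem bddAbove_sup [CompactSpace X] (f : Lip X) : BddAbove (range fun x : X => |f x|) :=
  (isCompact_range f.toContinuousMap.continuous.abs).bddAbove

theorem bddAbove_lip (f : Lip X) :
    BddAbove (range fun p : X × X => |f p.1 - f p.2| / dist p.1 p.2) := by
  obtain ⟨K, hK⟩ := f.lipschitz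
  refine ⟨K, ?_⟩
  rintro _ ⟨p, rfl⟩
  have h := hK.dist_le_mul p.1 p.2
  rw [Real.dist_eq] at h
  exact div_le_of_le_mul₀ dist_nonneg K.2 h

theorem supNorm_nonneg (f : Lip X) : 0 ≤ supNorm f := Real.iSup_nonneg fun _ => abs_nonneg _

theorem lipConst_nonneg (f : Lip X) : 0 ≤ lipConst f :=
  Real.iSup_nonneg fun _ => div_nonneg (abs_nonneg _) dist_nonneg

theorem core [CompactSpace X] : NormedSpace.Core ℝ (Lip X) where
  norm_nonneg f := add_nonneg f.supNorm_nonneg f.lipConst_nonneg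
  norm_smul c f := by
    have h1 : supNorm (c • f) = |c| * supNorm f := by
      unfold supNorm
      rw [Real.mul_iSup_of_nonneg (abs_nonneg c)]
      exact iSup_congr fun x => abs_mul c (f x)
    have h2 : lipConst (c • f) = |c| * lipConst f := by
      unfold lipConst
      rw [Real.mul_iSup_of_nonneg (abs_nonneg c)]
      refine iSup_congr fun p => ?_
      have : (c • f) p.1 - (c • f) p.2 = c * (f p.1 - f p.2) := (mul_sub c _ _).symm
      rw [this, abs_mul, mul_div_assoc]
    rw [norm_def, norm_def, h1, h2, Real.norm_eq_abs, mul_add]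
  norm_triangle f g := by
    have h1 : supNorm (f + g) ≤ supNorm f + supNorm g :=
      Real.iSup_le (fun x => (abs_add_le (f x) (g x)).trans
        (add_le_add (le_ciSup f.bddAbove_sup x) (le_ciSup g.bddAbove_sup x)))
        (add_nonneg f.supNorm_nonneg g.supNorm_nonneg)
    have h2 : lipConst (f + g) ≤ lipConst f + lipConst g := by
      refine Real.iSup_le (fun p => ?_) (add_nonneg f.lipConst_nonneg g.lipConst_nonneg)
      refine le_trans ?_ (add_le_add (le_ciSup f.bddAbove_lip p) (le_ciSup g.bddAbove_lip p))
      have : (f + g) p.1 - (f + g) p.2 = (f p.1 - f p.2) + (g p.1 - g p.2) :=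
        add_sub_add_comm _ _ _ _
      rw [this, ← add_div]
      exact div_le_div_of_nonneg_right (abs_add_le _ _) dist_nonneg
    rw [norm_def, norm_def, norm_def]
    linarith
  norm_eq_zero_iff f := by
    constructor
    · intro h
      rw [norm_def] at h
      have h0 : supNorm f = 0 := by linarith [f.supNorm_nonneg, f.lipConst_nonneg]
      refine Subtype.ext (funext fun x => ?_)
      have hx : |f x| ≤ 0 := h0 ▸ le_ciSup f.bddAbove_sup x
      exact abs_nonpos_iff.1 hx
    · rintro rfl
      have h1 : supNorm (0 : Lip X) = 0 := by
        have : ∀ x : X, |(0 : Lip X) x| = 0 := fun x => abs_zero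
        simp [supNorm, this]
      have h2 : lipConst (0 : Lip X) = 0 := by
        have : ∀ p : X × X, |(0 : Lip X) p.1 - (0 : Lip X) p.2| / dist p.1 p.2 = 0 := by
          intro p
          have : (0 : Lip X) p.1 - (0 : Lip X) p.2 = 0 := sub_zero (0 : ℝ)
          rw [this, abs_zero, zero_div]
        simp [lipConst, this]
      rw [norm_def, h1, h2, add_zero]

instance [CompactSpace X] : NormedAddCommGroup (Lip X) :=
  NormedAddCommGroup.ofCore core

instance [CompactSpace X] : NormedSpace ℝ (Lip X) := NormedSpace.ofCore core

instance [CompactSpace X] : MeasurableSpace (Lip X) := borel (Lip X)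

instance [CompactSpace X] : BorelSpace (Lip X) := ⟨rfl⟩

end Lip

/-- The set of Lipschitz functions with the locking property: there is a unique maximizing
measure, it is supported on a periodic orbit, and it is the unique maximizing measure of all
functions that are sufficiently close in the Lipschitz norm. -/
def Lock {X : Type*} [MetricSpace X] [CompactSpace X] [MeasurableSpace X] (T : X → X) :
    Set (Lip X) :=
  {f | ∃ ν : Measure X, IsUniqueMaximizing T f ν ∧ IsSupportedOnPeriodicOrbit T ν ∧
    ∀ᶠ g : Lip X in 𝓝 f, IsUniqueMaximizing T g ν}

end Lip

/-! ### The one-sided full shift on two symbols -/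

section Shift

/-- A strictly decreasing sequence of positive numbers converging to zero. -/
structure MetricSeq where
  toFun : ℕ → ℝ
  strictAnti : StrictAnti toFun
  pos : ∀ n, 0 < toFun n
  tendsto : Tendsto toFun atTop (𝓝 0)

/-- A strictly decreasing sequence of positive numbers with `a (n + 1) / a n = O(θ ^ n)`,
`0 < θ < 1 / 4`, converges to zero. -/
def MetricSeq.ofDecay (a : ℕ → ℝ) (ha : StrictAnti a) (hpos : ∀ n, 0 < a n)
    {θ : ℝ} (hθ : θ ∈ Ioo (0 : ℝ) (1 / 4))
    (hdecay : (fun n : ℕ => a (n + 1) / a n) =O[atTop] (fun n : ℕ => θ ^ n)) : MetricSeq where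
  toFun := a
  strictAnti := ha
  pos := hpos
  tendsto := by
    have h0 : Tendsto (fun n : ℕ => a (n + 1) / a n) atTop (𝓝 0) :=
      hdecay.trans_tendsto
        (tendsto_pow_atTop_nhds_zero_of_lt_one hθ.1.le (by linarith [hθ.2]))
    refine (summable_of_ratio_test_tendsto_lt_one (l := 0) one_pos
      (Eventually.of_forall fun n => (hpos n).ne') (h0.congr fun n => ?_)).tendsto_atTop_zero
    rw [Real.norm_of_nonneg (hpos _).le, Real.norm_of_nonneg (hpos _).le]

/-- The space `Σ⁺` of one-sided binary sequences, with the metric `d_a`. The entry with index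
`i : ℕ` is the `(i + 1)`-st symbol of the sequence. -/
def FullShift (_a : MetricSeq) : Type := ℕ → Bool

namespace FullShift

variable {a : MetricSeq}

/-- The left shift. -/
def shift (a : MetricSeq) (w : FullShift a) : FullShift a := fun i => w (i + 1)

/-- The product topology. -/
instance : TopologicalSpace (FullShift a) := inferInstanceAs (TopologicalSpace (ℕ → Bool))

instance : CompactSpace (FullShift a) := inferInstanceAs (CompactSpace (ℕ → Bool))

/-- The product σ-algebra; it is the Borel σ-algebra. -/
instance : MeasurableSpace (FullShift a) := inferInstanceAs (MeasurableSpace (ℕ → Bool))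

instance : BorelSpace (FullShift a) := inferInstanceAs (BorelSpace (ℕ → Bool))

open Classical in
/-- `d_a(w, z) = a_m`, where the `m`-th symbol (`m ≥ 1`) is the first one at which `w` and `z`
differ. As symbols are indexed from `0`, this is `m = firstDiff w z + 1`. -/
instance : Dist (FullShift a) :=
  ⟨fun w z => if w = z then 0
    else a.toFun (PiNat.firstDiff (E := fun _ => Bool) w z + 1)⟩

theorem dist_self' (w : FullShift a) : dist w w = 0 := if_pos rfl

theorem dist_of_ne {w z : FullShift a} (h : w ≠ z) :
    dist w z = a.toFun (PiNat.firstDiff (E := fun _ => Bool) w z + 1) := if_neg h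

theorem dist_lt_iff {w z : FullShift a} (n : ℕ) :
    dist w z < a.toFun n ↔ ∀ i < n, w i = z i := by
  by_cases h : w = z
  · subst h
    simp [dist_self', a.pos n]
  · rw [dist_of_ne h, a.strictAnti.lt_iff_gt]
    constructor
    · intro hn i hi
      exact PiNat.apply_eq_of_lt_firstDiff (E := fun _ => Bool) (by omega)
    · intro hn
      by_contra hlt
      exact PiNat.apply_firstDiff_ne (E := fun _ => Bool) h (hn _ (by omega))

theorem dist_triangle' (x y z : FullShift a) : dist x z ≤ dist x y + dist y z := by
  by_cases hxz : x = z
  · subst hxz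
    rw [dist_self']
    by_cases hxy : x = y
    · subst hxy; simp [dist_self']
    · rw [dist_of_ne hxy, dist_of_ne (Ne.symm hxy)]
      exact add_nonneg (a.pos _).le (a.pos _).le
  by_cases hxy : x = y
  · subst hxy; simp [dist_self']
  by_cases hyz : y = z
  · subst hyz; simp [dist_self']
  rw [dist_of_ne hxz, dist_of_ne hxy, dist_of_ne hyz]
  have h := PiNat.min_firstDiff_le (E := fun _ => Bool) x y z hxz
  rcases min_le_iff.1 h with h | h
  · have := a.strictAnti.antitone (Nat.succ_le_succ h)
    linarith [a.pos (PiNat.firstDiff (E := fun _ => Bool) y z + 1)]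
  · have := a.strictAnti.antitone (Nat.succ_le_succ h)
    linarith [a.pos (PiNat.firstDiff (E := fun _ => Bool) x y + 1)]

theorem isOpen_iff_dist' (s : Set (FullShift a)) :
    IsOpen s ↔ ∀ x ∈ s, ∃ ε > 0, ∀ y, dist x y < ε → y ∈ s := by
  constructor
  · intro hs x hx
    obtain ⟨v, ⟨y, n, rfl⟩, hxv, hvs⟩ :=
      (PiNat.isTopologicalBasis_cylinders fun _ => Bool).exists_subset_of_mem_open hx hs
    refine ⟨a.toFun n, a.pos n, fun z hz => hvs ?_⟩
    rw [dist_lt_iff] at hz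
    intro i hi
    rw [← hz i hi]
    exact hxv i hi
  · intro h
    rw [isOpen_iff_mem_nhds]
    intro x hx
    obtain ⟨ε, hε, hs⟩ := h x hx
    obtain ⟨n, hn⟩ := (a.tendsto.eventually (gt_mem_nhds hε)).exists
    refine mem_of_superset ((PiNat.isOpen_cylinder (fun _ => Bool) x n).mem_nhds
      (PiNat.self_mem_cylinder x n)) fun y hy => hs y (lt_trans ?_ hn)
    rw [dist_lt_iff]
    exact fun i hi => (hy i hi).symm

/-- The metric `d_a`; it induces the product topology. -/
instance : MetricSpace (FullShift a) :=
  MetricSpace.ofDistTopology dist dist_self'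
    (fun x y => by
      by_cases h : x = y
      · subst h; rfl
      · rw [dist_of_ne h, dist_of_ne (Ne.symm h)]
        exact congrArg (fun n => a.toFun (n + 1))
          (PiNat.firstDiff_comm (E := fun _ => Bool) x y))
    dist_triangle' isOpen_iff_dist'
    (fun x y h => by
      by_contra hne
      rw [dist_of_ne hne] at h
      exact (a.pos _).ne' h)

end FullShift

end Shift

end

/-!
Call the words of length `n + 1` the edges of a directed graph, the binary de Bruijn graph, whose
vertices are the words of length `n`. Since `a (n + 1) / a n` decays faster than `4⁻ⁿ`, a Lipschitz
function `f` is a weight on these edges up to an error of order `‖f‖ * a (n + 2)`, and even the sum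
of these errors along an orbit that follows a cycle for a while is of this order. The maximal
ergodic average is thus compared with the maximal mean weight of a simple cycle: if the best simple
cycle beats every other one by more than `5 * ‖f‖ * a (n + 2)`, then `f` and all nearby functions
are uniquely maximized by the periodic orbit along this cycle.

If there is no such margin, then for some edge `e` an optimal cycle through `e` nearly ties with a
cycle avoiding `e`. Perturb `f` by a sum over all words of random multiples of the indicator
functions of their cylinders, the multiples for the words of length `n + 1` being independent and
uniform on `[0, c n * a (n + 1)]`. Given all the other coefficients, a near tie at `e` confines the
one of `e` to an interval of length at most of order `2ⁿ * a (n + 2)`. Hence the margin is missing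
with probability at most of order `4ⁿ * a (n + 2) / (c n * a (n + 1))`, and there is a summable `c`
for which this tends to zero along a subsequence.
-/

open scoped BigOperators

/-! ### Simple cycles in directed multigraphs -/

section Graph

variable {E V : Type*} {s t : E → V} {γ c : ℕ → E} {p : ℕ}

/-- An infinite walk in the directed multigraph with edge set `E`, vertex set `V`, and source and
target maps `s` and `t`, given by its sequence of edges. -/
def IsWalk (s t : E → V) (γ : ℕ → E) : Prop :=
  ∀ i, t (γ i) = s (γ (i + 1))

/-- A simple cycle of length `p`, given by the `p`-periodic walk around it. -/
structure IsSimpleCycle (s t : E → V) (c : ℕ → E) (p : ℕ) : Prop where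
  pos : 0 < p
  walk : IsWalk s t c
  periodic : Function.Periodic c p
  injOn : InjOn (fun i => s (c i)) (Iio p)

/-- The simple cycles of a directed multigraph. A simple cycle is determined by its set of edges up
to the choice of a starting point, and is recorded as this set. -/
def simpleCycles (s t : E → V) : Set (Finset E) :=
  {S | ∃ c p, IsSimpleCycle s t c p ∧ (S : Set E) = range c}

namespace IsSimpleCycle

theorem modEq_of_source_eq (hc : IsSimpleCycle s t c p) {i j : ℕ} (h : s (c i) = s (c j)) :
    i ≡ j [MOD p] :=
  hc.injOn (Nat.mod_lt i hc.pos) (Nat.mod_lt j hc.pos) <| by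
    simpa only [hc.periodic.map_mod_nat] using h

theorem eq_of_source_eq (hc : IsSimpleCycle s t c p) {i j : ℕ} (h : s (c i) = s (c j)) :
    c i = c j := by
  rw [← hc.periodic.map_mod_nat i, ← hc.periodic.map_mod_nat j, hc.modEq_of_source_eq h]

theorem apply_add_eq (hc : IsSimpleCycle s t c p) {i j : ℕ} (h : c i = c j) (k : ℕ) :
    c (i + k) = c (j + k) := by
  have hij : (i + k) % p = (j + k) % p :=
    (hc.modEq_of_source_eq (congrArg s h)).add_right k
  rw [← hc.periodic.map_mod_nat (i + k), ← hc.periodic.map_mod_nat (j + k), hij]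

theorem walk_eq_of_mem_range (hc : IsSimpleCycle s t c p) (hγ : IsWalk s t γ) {j n : ℕ}
    (h0 : γ 0 = c j) (hmem : ∀ k ≤ n, γ k ∈ range c) : γ n = c (j + n) := by
  induction n with
  | zero => exact h0
  | succ n ih =>
    obtain ⟨m, hm⟩ := hmem (n + 1) le_rfl
    rw [← hm]
    apply hc.eq_of_source_eq
    rw [hm, ← hγ n, ih fun k hk => hmem k (hk.trans n.le_succ), hc.walk, add_assoc]

theorem range_subset_of_range_subset (hc : IsSimpleCycle s t c p) (hγ : IsWalk s t γ)
    (hsub : range γ ⊆ range c) : range c ⊆ range γ := by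
  obtain ⟨j, hj⟩ := hsub (mem_range_self 0)
  rintro _ ⟨i, rfl⟩
  refine ⟨i + j * (p - 1), ?_⟩
  rw [hc.walk_eq_of_mem_range hγ hj.symm fun k _ => hsub (mem_range_self k)]
  obtain ⟨r, rfl⟩ : ∃ r, p = r + 1 := ⟨p - 1, (Nat.sub_add_cancel hc.pos).symm⟩
  rw [Nat.add_sub_cancel, show j + (i + j * r) = i + j * (r + 1) by ring]
  exact hc.periodic.nat_mul j i

theorem sum_range_eq (hc : IsSimpleCycle s t c p) {S : Finset E} (hS : (S : Set E) = range c)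
    {M : Type*} [AddCommMonoid M] (w : E → M) : ∑ k ∈ Finset.range p, w (c k) = ∑ e ∈ S, w e := by
  refine Finset.sum_nbij c (fun i _ => ?_) (fun i hi j hj hij => ?_) (fun e he => ?_) fun _ _ => rfl
  · rw [← Finset.mem_coe, hS]
    exact mem_range_self i
  · rw [Finset.coe_range] at hi hj
    exact hc.injOn hi hj (congrArg s hij)
  · obtain ⟨i, rfl⟩ := hS ▸ he
    exact ⟨i % p, by simpa using Nat.mod_lt i hc.pos, hc.periodic.map_mod_nat i⟩

theorem card_eq (hc : IsSimpleCycle s t c p) {S : Finset E} (hS : (S : Set E) = range c) :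
    S.card = p := by
  rw [Finset.card_eq_sum_ones, ← hc.sum_range_eq hS, ← Finset.card_eq_sum_ones, Finset.card_range]

theorem expect_eq (hc : IsSimpleCycle s t c p) {S : Finset E} (hS : (S : Set E) = range c)
    (w : E → ℝ) : 𝔼 e ∈ S, w e = (∑ k ∈ Finset.range p, w (c k)) / p := by
  rw [Finset.expect_eq_sum_div_card, hc.card_eq hS, hc.sum_range_eq hS]

end IsSimpleCycle

theorem card_le_of_mem_simpleCycles [Fintype V] {S : Finset E} (hS : S ∈ simpleCycles s t) :
    S.card ≤ Fintype.card V := by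
  obtain ⟨c, p, hc, hSc⟩ := hS
  have hinj : InjOn (fun i => s (c i)) (Finset.range p) := by simpa using hc.injOn
  simpa [hc.card_eq hSc] using Finset.card_le_card_of_injOn _ (fun _ _ => Finset.mem_univ _) hinj

theorem isAntichain_simpleCycles (s t : E → V) : IsAntichain (· ⊆ ·) (simpleCycles s t) := by
  rintro S ⟨γ, q, hγ, hS⟩ S' ⟨c, p, hc, hS'⟩ hne hsub
  refine hne (Finset.Subset.antisymm hsub ?_)
  rw [← Finset.coe_subset, hS, hS'] at hsub ⊢
  exact hc.range_subset_of_range_subset hγ.walk hsub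

/-- The sequence obtained from `γ` by removing the `d` entries with indices from `i` on. -/
def excise (γ : ℕ → E) (i d : ℕ) : ℕ → E :=
  fun k => if k < i then γ k else γ (k + d)

theorem sum_eq_sum_add_sum_excise {M : Type*} [AddCommMonoid M] (w : E → M) (γ : ℕ → E)
    (i d r : ℕ) : ∑ k ∈ Finset.range (i + d + r), w (γ k) =
      ∑ k ∈ Finset.range d, w (γ (i + k)) + ∑ k ∈ Finset.range (i + r), w (excise γ i d k) := by
  have hbefore : ∑ k ∈ Finset.range i, w (excise γ i d k) = ∑ k ∈ Finset.range i, w (γ k) :=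
    Finset.sum_congr rfl fun k hk => by rw [excise, if_pos (Finset.mem_range.1 hk)]
  have hafter (k : ℕ) : excise γ i d (i + k) = γ (i + d + k) := by
    rw [excise, if_neg (by lia), add_right_comm]
  simp only [Finset.sum_range_add, hbefore, hafter]
  abel

theorem isWalk_excise (hγ : IsWalk s t γ) {i d : ℕ} (h : s (γ i) = s (γ (i + d))) :
    IsWalk s t (excise γ i d) := by
  intro k
  unfold excise
  rcases lt_trichotomy (k + 1) i with hk | rfl | hk
  · rw [if_pos hk, if_pos (by lia), hγ]
  · rw [if_pos k.lt_succ_self, if_neg (lt_irrefl _), hγ, h]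
  · rw [if_neg (by lia), if_neg (by lia), hγ, add_right_comm]

namespace IsWalk

theorem exists_isSimpleCycle [Fintype V] (hγ : IsWalk s t γ) :
    ∃ i d, i + d ≤ Fintype.card V ∧ s (γ i) = s (γ (i + d)) ∧
      IsSimpleCycle s t (fun k => γ (i + k % d)) d := by
  classical
  have hreturn : ∃ d > 0, ∃ i, i + d ≤ Fintype.card V ∧ s (γ i) = s (γ (i + d)) := by
    obtain ⟨i, j, hne, hij⟩ := Fintype.exists_ne_map_eq_of_card_lt
      (fun i : Fin (Fintype.card V + 1) => s (γ i)) (by simp)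
    wlog hlt : i < j generalizing i j
    · exact this j i hne.symm hij.symm (lt_of_le_of_ne (not_lt.1 hlt) hne.symm)
    have hlt' : (i : ℕ) < j := hlt
    exact ⟨j - i, by lia, i, by lia, by rwa [Nat.add_sub_of_le hlt'.le]⟩
  -- a shortest return has no repeated vertex
  obtain ⟨hpos, i, hle, hi⟩ := Nat.find_spec hreturn
  have hmin := fun d => Nat.find_min hreturn (m := d)
  set d := Nat.find hreturn
  refine ⟨i, d, hle, hi, hpos, fun k => ?_, fun k => by simp, ?_⟩
  · rw [hγ, add_assoc, ← Nat.mod_add_mod k d 1]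
    obtain hk | hk : k % d + 1 < d ∨ k % d + 1 = d :=
      lt_or_eq_of_le (Nat.mod_lt k hpos)
    · rw [Nat.mod_eq_of_lt hk]
    · rw [hk, Nat.mod_self, add_zero, hi]
  · intro j hj k hk hjk
    wlog hlt : j < k generalizing j k
    · exact (not_lt.1 hlt).lt_or_eq.elim (fun h => (this hk hj hjk.symm h).symm) Eq.symm
    simp only [Nat.mod_eq_of_lt hj, Nat.mod_eq_of_lt hk] at hjk
    have hk : k < d := hk
    refine absurd ⟨by lia, i + j, by lia, ?_⟩ (hmin (k - j) (by lia))
    rwa [add_assoc, Nat.add_sub_of_le hlt.le]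

theorem sum_le [Fintype V] [Fintype E] {w : E → ℝ}
    (hw : ∀ S ∈ simpleCycles s t, ∑ e ∈ S, w e ≤ 0) (hγ : IsWalk s t γ) (q : ℕ) :
    ∑ k ∈ Finset.range q, w (γ k) ≤ Fintype.card V * ∑ e, |w e| := by
  induction q using Nat.strong_induction_on generalizing γ with
  | _ q ih =>
    rcases le_total q (Fintype.card V) with hq | hq
    · calc ∑ k ∈ Finset.range q, w (γ k) ≤ ∑ _k ∈ Finset.range q, ∑ e, |w e| :=
            Finset.sum_le_sum fun k _ => (le_abs_self _).trans <|
              Finset.single_le_sum (f := fun e => |w e|) (fun _ _ => abs_nonneg _)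
                (Finset.mem_univ (γ k))
        _ = q * ∑ e, |w e| := by simp
        _ ≤ Fintype.card V * ∑ e, |w e| := by gcongr
    · obtain ⟨i, d, hle, hi, hcycle⟩ := hγ.exists_isSimpleCycle
      obtain ⟨r, rfl⟩ := Nat.exists_eq_add_of_le (hle.trans hq)
      obtain ⟨S, hS⟩ := (toFinite (range fun k => γ (i + k % d))).exists_finset_coe
      have hsegment : ∑ k ∈ Finset.range d, w (γ (i + k)) = ∑ e ∈ S, w e := by
        rw [← hcycle.sum_range_eq hS]
        exact Finset.sum_congr rfl fun k hk => by rw [Nat.mod_eq_of_lt (Finset.mem_range.1 hk)]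
      rw [sum_eq_sum_add_sum_excise, hsegment]
      have hd := hcycle.pos
      linarith [hw S ⟨_, _, hcycle, hS⟩, ih (i + r) (by lia) (isWalk_excise hγ hi)]

end IsWalk

end Graph

/-! ### Isolated optima and near ties -/

section Isolation

variable {E : Type*} {Z : Set (Finset E)} {W W' : E → ℝ} {S : Finset E} {δ ε : ℝ}

/-- In mean weight, the member `S` of `Z` exceeds all other members by at least `δ`. -/
structure IsDominant (Z : Set (Finset E)) (δ : ℝ) (W : E → ℝ) (S : Finset E) : Prop where
  mem : S ∈ Z
  expect_add_le : ∀ S' ∈ Z, S' ≠ S → 𝔼 e ∈ S', W e + δ ≤ 𝔼 e ∈ S, W e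

/-- A member of `Z` that contains `e` has optimal mean weight, but exceeds by at most `δ` a member
that does not contain `e`. If this fails for all `e`, the optimum is isolated. -/
def IsNearTie (Z : Set (Finset E)) (δ : ℝ) (e : E) (W : E → ℝ) : Prop :=
  ∃ S ∈ Z, ∃ S' ∈ Z, e ∈ S ∧ e ∉ S' ∧ (∀ R ∈ Z, 𝔼 i ∈ R, W i ≤ 𝔼 i ∈ S, W i) ∧
    𝔼 i ∈ S, W i ≤ 𝔼 i ∈ S', W i + δ

theorem abs_expect_sub_expect_le (hε : 0 ≤ ε) (h : ∀ e, |W' e - W e| ≤ ε) (S : Finset E) :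
    |𝔼 e ∈ S, W' e - 𝔼 e ∈ S, W e| ≤ ε := by
  rcases S.eq_empty_or_nonempty with rfl | hS
  · simpa using hε
  · rw [← Finset.expect_sub_distrib]
    exact (Finset.abs_expect_le S _).trans (Finset.expect_le hS fun e _ => h e)

namespace IsDominant

theorem of_abs_sub_le (hS : IsDominant Z δ W S) (hε : 0 ≤ ε) (h : ∀ e, |W' e - W e| ≤ ε) :
    IsDominant Z (δ - 2 * ε) W' S := by
  refine ⟨hS.mem, fun S' hS' hne => ?_⟩
  have h1 := (abs_le.1 (abs_expect_sub_expect_le hε h S)).1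
  have h2 := (abs_le.1 (abs_expect_sub_expect_le hε h S')).2
  linarith [hS.expect_add_le S' hS' hne]

theorem sum_le_zero [DecidableEq E] (hS : IsDominant Z δ W S) (hδ : 0 ≤ δ) {S' : Finset E}
    (hS' : S' ∈ Z) : ∑ e ∈ S', (W e - 𝔼 i ∈ S, W i + if e ∈ S then 0 else δ) ≤ 0 := by
  rcases eq_or_ne S' S with rfl | hne
  · rw [Finset.sum_congr rfl fun e he => by rw [if_pos he, add_zero], Finset.sum_sub_distrib,
      Finset.sum_const, Finset.card_smul_expect, sub_self]
  · calc ∑ e ∈ S', (W e - 𝔼 i ∈ S, W i + if e ∈ S then 0 else δ)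
        ≤ ∑ e ∈ S', (W e - 𝔼 i ∈ S, W i + δ) := by
          gcongr with e
          split_ifs
          exacts [hδ, le_rfl]
      _ = S'.card • (𝔼 e ∈ S', W e + δ - 𝔼 e ∈ S, W e) := by
          rw [Finset.sum_add_distrib, Finset.sum_sub_distrib, Finset.sum_const, Finset.sum_const,
            ← Finset.card_smul_expect, ← smul_sub, ← smul_add, sub_add_eq_add_sub]
      _ ≤ 0 := smul_nonpos_of_nonneg_of_nonpos S'.card.zero_le <| sub_nonpos.2 <|
          hS.expect_add_le S' hS' hne

end IsDominant

theorem exists_isDominant [Finite E] (hZ : IsAntichain (· ⊆ ·) Z) (hne : Z.Nonempty)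
    (hW : ∀ e, ¬ IsNearTie Z δ e W) : ∃ S, IsDominant Z δ W S := by
  obtain ⟨S, hS, hmax⟩ := Z.exists_max_image (fun S => 𝔼 e ∈ S, W e) Z.toFinite hne
  refine ⟨S, hS, fun S' hS' hSS' => ?_⟩
  obtain ⟨e, heS, heS'⟩ := Finset.not_subset.1 (hZ hS hS' hSS'.symm)
  by_contra! hlt
  exact hW e ⟨S, hS, S', hS', heS, heS', hmax, hlt.le⟩

theorem isClosed_isNearTie [Finite E] (Z : Set (Finset E)) (δ : ℝ) (e : E) :
    IsClosed {W : E → ℝ | IsNearTie Z δ e W} := by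
  have hcont (S : Finset E) : Continuous fun W : E → ℝ => 𝔼 i ∈ S, W i := by
    simp only [Finset.expect_eq_sum_div_card]
    fun_prop
  have hunion : {W : E → ℝ | IsNearTie Z δ e W} = ⋃ S ∈ {S ∈ Z | e ∈ S}, ⋃ S' ∈ {S' ∈ Z | e ∉ S'},
      {W | (∀ R ∈ Z, 𝔼 i ∈ R, W i ≤ 𝔼 i ∈ S, W i) ∧ 𝔼 i ∈ S, W i ≤ 𝔼 i ∈ S', W i + δ} := by
    ext W
    simp only [IsNearTie, mem_ofPred_eq, mem_iUnion, exists_prop]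
    grind
  rw [hunion]
  refine (toFinite _).isClosed_biUnion fun S _ => (toFinite _).isClosed_biUnion fun S' _ => ?_
  simp only [ofPred_and, ofPred_forall]
  exact (isClosed_biInter fun R _ => isClosed_le (hcont R) (hcont S)).inter
    (isClosed_le (hcont S) ((hcont S').add continuous_const))

theorem expect_sub_expect_of_mem {e : E} (he : e ∈ S) (h : ∀ i ≠ e, W i = W' i) :
    𝔼 i ∈ S, W' i - 𝔼 i ∈ S, W i = (W' e - W e) / S.card := by
  rw [← Finset.expect_sub_distrib, Finset.expect_eq_sum_div_card,
    Finset.sum_eq_single_of_mem e he fun i _ hi => by rw [h i hi, sub_self]]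

/-- Raising the weight of `e` by `x` raises the optimum by at least `x / N` but does not affect the
members avoiding `e`, so the near ties at `e` occupy an interval of length at most `N * δ`. -/
theorem IsNearTie.abs_sub_le {N : ℕ} (hN : ∀ S ∈ Z, S.card ≤ N) {e : E}
    (h : IsNearTie Z δ e W) (h' : IsNearTie Z δ e W') (hWW' : ∀ i ≠ e, W i = W' i) :
    |W' e - W e| ≤ N * δ := by
  wlog hle : W e ≤ W' e generalizing W W'
  · rw [abs_sub_comm]
    exact this h' h (fun i hi => (hWW' i hi).symm) (le_of_not_ge hle)
  obtain ⟨S, hS, -, -, heS, -, hopt, -⟩ := h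
  obtain ⟨R, -, R', hR', -, heR', hopt', hδ⟩ := h'
  have hcard : (0 : ℝ) < S.card := by exact_mod_cast Finset.card_pos.2 ⟨e, heS⟩
  have havoid : 𝔼 i ∈ R', W' i = 𝔼 i ∈ R', W i :=
    Finset.expect_congr rfl fun i hi => (hWW' i (ne_of_mem_of_not_mem hi heR')).symm
  have hincrease : W' e - W e ≤ S.card * δ := by
    rw [mul_comm, ← div_le_iff₀ hcard, ← expect_sub_expect_of_mem heS hWW']
    linarith [hopt R' hR', hopt' S hS]
  have hδ0 : 0 ≤ δ := nonneg_of_mul_nonneg_right ((sub_nonneg.2 hle).trans hincrease) hcard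
  rw [abs_of_nonneg (sub_nonneg.2 hle)]
  exact hincrease.trans (mul_le_mul_of_nonneg_right (by exact_mod_cast hN S hS) hδ0)

end Isolation

/-! ### Birkhoff sums and periodic orbits -/

section Orbit

variable {X : Type*} {T : X → X} {p : X} {q : ℕ}

theorem birkhoffSum_apply_of_isPeriodicPt {M : Type*} [AddCommMonoid M]
    (hp : Function.IsPeriodicPt T q p) (h : X → M) :
    birkhoffSum T h q (T p) = birkhoffSum T h q p := by
  cases q with
  | zero => simp only [birkhoffSum_zero]
  | succ r =>
    rw [birkhoffSum_succ, birkhoffSum_succ', ← Function.iterate_succ_apply, hp.eq, add_comm]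

theorem birkhoffSum_iterate_of_isPeriodicPt {M : Type*} [AddCommMonoid M]
    (hp : Function.IsPeriodicPt T q p) (h : X → M) (n : ℕ) :
    birkhoffSum T h q (T^[n] p) = birkhoffSum T h q p := by
  induction n with
  | zero => rfl
  | succ n ih =>
    rw [Function.iterate_succ_apply', birkhoffSum_apply_of_isPeriodicPt (hp.apply_iterate n), ih]

/-- A visit to `C` contributes at most `B`, and this is paid back when the orbit leaves `C`. -/
theorem birkhoffSum_le_of_exit {D : X → ℝ} {C : Set X} {b : ℕ → ℝ} {B : ℝ}
    (hB : ∀ j, ∑ k ∈ Finset.range j, b k ≤ B) (hb : ∀ k, 0 ≤ b k)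
    (hout : ∀ x ∉ C, D x + B ≤ 0)
    (hexit : ∀ x j, (∀ k ≤ j, T^[k] x ∈ C) → T^[j + 1] x ∉ C → D x ≤ b j)
    (hstay : ∀ x, (∀ k, T^[k] x ∈ C) → D x ≤ 0) (N : ℕ) (x : X) :
    birkhoffSum T D N x ≤ B := by
  have of_exit (N : ℕ) (h : ∀ x j, (∀ k < j, T^[k] x ∈ C) → T^[j] x ∉ C →
      birkhoffSum T D N x ≤ ∑ k ∈ Finset.range j, b k) (x : X) : birkhoffSum T D N x ≤ B := by
    by_cases hx : ∀ k, T^[k] x ∈ C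
    · refine (Finset.sum_nonpos fun i _ => hstay _ fun k => ?_).trans (hB 0)
      rw [← Function.iterate_add_apply]
      exact hx (k + i)
    · classical
      push Not at hx
      exact (h x (Nat.find hx) (fun k hk => not_not.1 (Nat.find_min hx hk))
        (Nat.find_spec hx)).trans (hB _)
  refine of_exit N ?_ x
  induction N with
  | zero => exact fun x j _ _ => Finset.sum_nonneg fun k _ => hb k
  | succ N ih =>
    intro x j hj hj'
    rw [birkhoffSum_succ']
    cases j with
    | zero =>
      rw [Finset.range_zero, Finset.sum_empty]
      linarith [hout x hj', of_exit N ih (T x)]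
    | succ j =>
      rw [Finset.sum_range_succ]
      linarith [hexit x j (fun k hk => hj k (by lia)) hj',
        ih (T x) j (fun k hk => hj (k + 1) (by lia)) hj']

variable [MeasurableSpace X] {μ : Measure X}

theorem lintegral_birkhoffSum (hT : MeasurePreserving T μ μ) {h : X → ENNReal}
    (hh : Measurable h) (N : ℕ) : ∫⁻ x, birkhoffSum T h N x ∂μ = N * ∫⁻ x, h x ∂μ :=
  (lintegral_finsetSum _ fun i _ => hh.comp (hT.iterate i).measurable).trans <| by
    simp [(hT.iterate _).lintegral_comp hh]

theorem integral_birkhoffSum (hT : MeasurePreserving T μ μ) {h : X → ℝ} (hh : Integrable h μ)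
    (N : ℕ) : ∫ x, birkhoffSum T h N x ∂μ = N * ∫ x, h x ∂μ := by
  have hiterate (i : ℕ) : ∫ x, h (T^[i] x) ∂μ = ∫ x, h x ∂μ := by
    have hm := hT.iterate i
    rw [← integral_map hm.aemeasurable (by rw [hm.map_eq]; exact hh.aestronglyMeasurable),
      hm.map_eq]
  exact (integral_finsetSum _ fun i _ => (hT.iterate i).integrable_comp_of_integrable hh).trans <|
    by simp [hiterate]

theorem integrable_birkhoffSum (hT : MeasurePreserving T μ μ) {h : X → ℝ} (hh : Integrable h μ)
    (N : ℕ) : Integrable (birkhoffSum T h N) μ :=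
  integrable_finsetSum _ fun i _ => (hT.iterate i).integrable_comp_of_integrable hh

theorem integral_nonpos_of_birkhoffSum_le [IsFiniteMeasure μ] (hT : MeasurePreserving T μ μ)
    {h : X → ℝ} (hh : Integrable h μ) {K : ℝ} (hK : ∀ N x, birkhoffSum T h N x ≤ K) :
    ∫ x, h x ∂μ ≤ 0 := by
  have hle (N : ℕ) : N * ∫ x, h x ∂μ ≤ μ.real univ * K := by
    rw [← integral_birkhoffSum hT hh, ← smul_eq_mul (μ.real univ), ← integral_const]
    exact integral_mono (integrable_birkhoffSum hT hh N) (integrable_const K) (hK N)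
  by_contra! hpos
  obtain ⟨N, hN⟩ := exists_nat_gt (μ.real univ * K / ∫ x, h x ∂μ)
  exact (hle N).not_gt ((div_lt_iff₀ hpos).1 hN)

/-- The uniform distribution on the points `p, T p, …, T^[q - 1] p`. -/
noncomputable def orbitMeasure (T : X → X) (q : ℕ) (p : X) : Measure X :=
  (q : ENNReal)⁻¹ • birkhoffSum T Measure.dirac q p

theorem orbitMeasure_apply {A : Set X} (hA : MeasurableSet A) :
    orbitMeasure T q p A = (q : ENNReal)⁻¹ * birkhoffSum T (A.indicator 1) q p := by
  simp [orbitMeasure, birkhoffSum, Measure.finsetSum_apply, hA]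

theorem integral_orbitMeasure {f : X → ℝ} (hf : StronglyMeasurable f) (q : ℕ) (p : X) :
    ∫ x, f x ∂(orbitMeasure T q p) = birkhoffAverage ℝ T f q p := by
  rw [orbitMeasure, birkhoffSum, integral_smul_measure, integral_finsetSum_measure fun i _ =>
    integrable_dirac' hf (by simp)]
  simp [integral_dirac' _ _ hf, birkhoffAverage, birkhoffSum]

theorem isInvariantProb_orbitMeasure (hT : Measurable T) (hq : 0 < q)
    (hp : Function.IsPeriodicPt T q p) : IsInvariantProb T (orbitMeasure T q p) := by
  refine ⟨⟨?_⟩, hT, Measure.ext fun A hA => ?_⟩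
  · rw [orbitMeasure_apply MeasurableSet.univ]
    simp [birkhoffSum, ENNReal.inv_mul_cancel, hq.ne']
  · rw [Measure.map_apply hT hA, orbitMeasure_apply (hT hA), orbitMeasure_apply hA,
      ← birkhoffSum_apply_of_isPeriodicPt hp (A.indicator 1)]
    simp only [birkhoffSum, ← Function.iterate_succ_apply, Function.iterate_succ_apply']
    rfl

theorem isSupportedOnPeriodicOrbit_orbitMeasure [MeasurableSingletonClass X] (hq : 0 < q)
    (hp : Function.IsPeriodicPt T q p) : IsSupportedOnPeriodicOrbit T (orbitMeasure T q p) := by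
  refine ⟨p, Function.mk_mem_periodicPts hq hp, ?_⟩
  rw [orbitMeasure_apply (countable_range _).measurableSet.compl]
  simp [birkhoffSum]

theorem IsInvariantProb.eq_orbitMeasure (hμ : IsInvariantProb T μ) (hq : 0 < q)
    (hp : Function.IsPeriodicPt T q p) (hsupp : ∀ᵐ x ∂μ, x ∈ range fun n : ℕ => T^[n] p) :
    μ = orbitMeasure T q p := by
  have := hμ.1
  ext A hA
  have hsum : (q : ENNReal) * μ A = birkhoffSum T (A.indicator 1) q p := by
    calc (q : ENNReal) * μ A = ∫⁻ x, birkhoffSum T (A.indicator 1) q x ∂μ := by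
          rw [lintegral_birkhoffSum hμ.2 (measurable_one.indicator hA), lintegral_indicator_one hA]
      _ = ∫⁻ _, birkhoffSum T (A.indicator 1) q p ∂μ := by
          refine lintegral_congr_ae ?_
          filter_upwards [hsupp]
          rintro _ ⟨n, rfl⟩
          exact birkhoffSum_iterate_of_isPeriodicPt hp _ n
      _ = birkhoffSum T (A.indicator 1) q p := by simp
  rw [orbitMeasure_apply hA, ← hsum, ← mul_assoc,
    ENNReal.inv_mul_cancel (by exact_mod_cast hq.ne') (by simp), one_mul]

theorem IsInvariantProb.integral_add_le {g : X → ℝ} {C : Set X} {α η K : ℝ}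
    (hμ : IsInvariantProb T μ) (hg : Integrable g μ) (hC : MeasurableSet C)
    (hK : ∀ N x, birkhoffSum T (fun y => g y - α + Cᶜ.indicator (fun _ => η) y) N x ≤ K) :
    ∫ x, g x ∂μ + μ.real Cᶜ * η ≤ α := by
  have := hμ.1
  have hsub : Integrable (fun x => g x - α) μ := hg.sub (integrable_const α)
  have hind : Integrable (Cᶜ.indicator fun _ => η) μ := (integrable_const η).indicator hC.compl
  have hnonpos := integral_nonpos_of_birkhoffSum_le hμ.2 (hsub.add hind) hK
  simp only [Pi.add_apply] at hnonpos
  rw [integral_add hsub hind, integral_sub hg (integrable_const α), integral_const,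
    integral_indicator_const _ hC.compl, probReal_univ, one_smul, smul_eq_mul] at hnonpos
  linarith

/-- The gain `η` off `C` makes every maximizing measure live on `C`, and hence on the orbit
of `p`. -/
theorem isUniqueMaximizing_orbitMeasure (hT : Measurable T) {g : X → ℝ} (hg : Measurable g)
    {M : ℝ} (hM : ∀ x, |g x| ≤ M) (hq : 0 < q) (hp : Function.IsPeriodicPt T q p)
    {C : Set X} (hC : MeasurableSet C)
    (horb : ∀ x, (∀ k, T^[k] x ∈ C) → x ∈ range fun n : ℕ => T^[n] p) {η K : ℝ} (hη : 0 < η)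
    (hK : ∀ N x, birkhoffSum T
      (fun y => g y - birkhoffAverage ℝ T g q p + Cᶜ.indicator (fun _ => η) y) N x ≤ K) :
    IsUniqueMaximizing T g (orbitMeasure T q p) := by
  have hbound (ν : Measure X) (hν : IsInvariantProb T ν) :
      ∫ x, g x ∂ν + ν.real Cᶜ * η ≤ ∫ x, g x ∂(orbitMeasure T q p) := by
    have := hν.1
    rw [integral_orbitMeasure hg.stronglyMeasurable]
    exact hν.integral_add_le
      (Integrable.of_bound hg.aestronglyMeasurable M (Eventually.of_forall hM)) hC hK
  have hinv := isInvariantProb_orbitMeasure hT hq hp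
  refine ⟨⟨hinv, fun ν hν => ?_⟩, fun ν hν => hν.1.eq_orbitMeasure hq hp ?_⟩
  · exact le_of_add_le_of_nonneg_left (hbound ν hν) (mul_nonneg measureReal_nonneg hη.le)
  · have := hν.1.1
    have hCnull : ν.real Cᶜ = 0 := by
      refine le_antisymm (nonpos_of_mul_nonpos_left ?_ hη) measureReal_nonneg
      linarith [hbound ν hν.1, hν.2 _ hinv]
    have hCae : ∀ᵐ x ∂ν, x ∈ C := (measureReal_eq_zero_iff).1 hCnull
    have hstay : ∀ᵐ x ∂ν, ∀ k, T^[k] x ∈ C :=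
      ae_all_iff.2 fun k => (hν.1.2.iterate k).quasiMeasurePreserving.ae hCae
    filter_upwards [hstay] using horb

end Orbit

/-! ### Locking on the full shift -/

namespace Lip

variable {X : Type*} [MetricSpace X]

@[simp] theorem add_apply (f g : Lip X) (x : X) : (f + g) x = f x + g x := rfl

theorem continuous (f : Lip X) : Continuous f := f.toContinuousMap.continuous

theorem abs_sub_le (f : Lip X) (x y : X) : |f x - f y| ≤ ‖f‖ * dist x y := by
  rcases eq_or_ne x y with rfl | hxy
  · simp
  · rw [← div_le_iff₀ (dist_pos.2 hxy)]
    exact (le_ciSup f.bddAbove_lip (x, y)).trans (le_add_of_nonneg_left f.supNorm_nonneg)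

theorem norm_le_add {f : Lip X} {K L : ℝ} (hK : 0 ≤ K) (hL : 0 ≤ L) (hsup : ∀ x, |f x| ≤ K)
    (hlip : ∀ x y, |f x - f y| ≤ L * dist x y) : ‖f‖ ≤ K + L :=
  add_le_add (Real.iSup_le hsup hK) <|
    Real.iSup_le (fun p => div_le_of_le_mul₀ dist_nonneg hL (hlip p.1 p.2)) hL

variable [CompactSpace X]

theorem abs_apply_le (f : Lip X) (x : X) : |f x| ≤ ‖f‖ :=
  (le_ciSup f.bddAbove_sup x).trans (le_add_of_nonneg_right f.lipConst_nonneg)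

theorem continuous_eval (x : X) : Continuous fun f : Lip X => f x :=
  (LipschitzWith.of_dist_le_mul (K := 1) fun f g => by
    rw [NNReal.coe_one, one_mul, dist_eq_norm f g]
    exact (f - g).abs_apply_le x).continuous

end Lip

theorem isOpen_lock {X : Type*} [MetricSpace X] [CompactSpace X] [MeasurableSpace X]
    (T : X → X) : IsOpen (Lock T) := by
  rw [isOpen_iff_mem_nhds]
  rintro f ⟨ν, -, hper, hev⟩
  filter_upwards [eventually_eventually_nhds.2 hev] with g hg
  exact ⟨ν, hg.self_of_nhds, hper, hg⟩

theorem sum_range_le_two_mul {u : ℕ → ℝ} (hu : ∀ k, 0 ≤ u k) (h : ∀ k, u (k + 1) ≤ u k / 2)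
    (j : ℕ) : ∑ k ∈ Finset.range j, u k ≤ 2 * u 0 := by
  induction j generalizing u with
  | zero => simpa using hu 0
  | succ j ih =>
    rw [Finset.sum_range_succ']
    linarith [ih (fun k => hu (k + 1)) (fun k => h (k + 1)), h 0]

/-- The simple cycles of the binary de Bruijn graph. Its edges are the words of length `n + 1`,
leading from their initial to their final subword of length `n`. -/
def deBruijnCycles (n : ℕ) : Set (Finset (Fin (n + 1) → Bool)) :=
  simpleCycles (V := Fin n → Bool) Fin.init Fin.tail

theorem deBruijnCycles_nonempty (n : ℕ) : (deBruijnCycles n).Nonempty :=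
  ⟨{fun _ => false}, fun _ _ => false, 1,
    ⟨one_pos, fun _ => rfl, fun _ => rfl, by simp⟩, by simp⟩

namespace FullShift

variable {a : MetricSeq} {n : ℕ} {x y : FullShift a}

theorem shift_iterate_apply (k : ℕ) (x : FullShift a) (i : ℕ) :
    (shift a)^[k] x i = x (i + k) := by
  induction k generalizing i with
  | zero => rfl
  | succ k ih =>
    rw [Function.iterate_succ_apply']
    exact (ih (i + 1)).trans (congrArg x (Nat.succ_add_eq_add_succ i k))

theorem measurable_shift : Measurable (shift a) :=
  measurable_pi_lambda _ fun i => measurable_pi_apply (i + 1)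

theorem dist_le_of_forall_lt {m : ℕ} (h : ∀ i < m, x i = y i) : dist x y ≤ a.toFun (m + 1) := by
  rcases eq_or_ne x y with rfl | hxy
  · exact (dist_self x).trans_le (a.pos _).le
  · rw [dist_of_ne hxy]
    refine a.strictAnti.antitone (Nat.succ_le_succ ?_)
    by_contra! hlt
    exact PiNat.apply_firstDiff_ne (E := fun _ => Bool) hxy (h _ hlt)

/-- The word formed by the first `n + 1` symbols of a sequence. -/
def word (n : ℕ) (x : FullShift a) : Fin (n + 1) → Bool := fun i => x i

/-- The sequence that starts with the word `e` and continues with zeros; a reference point in the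
cylinder of `e`. -/
def pad (a : MetricSeq) (e : Fin (n + 1) → Bool) : FullShift a :=
  fun i => if h : i < n + 1 then e ⟨i, h⟩ else false

@[simp] theorem word_pad (e : Fin (n + 1) → Bool) : word n (pad a e) = e :=
  funext fun i => dif_pos i.2

theorem continuous_word : Continuous (word n : FullShift a → _) :=
  continuous_pi fun i => continuous_apply (A := fun _ : ℕ => Bool) (i : ℕ)

theorem dist_le_of_word_eq (h : word n x = word n y) : dist x y ≤ a.toFun (n + 2) :=
  dist_le_of_forall_lt fun i hi => congrFun h ⟨i, hi⟩

theorem isWalk_word (n : ℕ) (x : FullShift a) :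
    IsWalk (V := Fin n → Bool) Fin.init Fin.tail fun k => word n ((shift a)^[k] x) := by
  intro k
  beta_reduce
  rw [Function.iterate_succ_apply']
  rfl

/-- The sequence whose shifts begin with the words of the walk `c` in the de Bruijn graph. -/
def walkPoint (a : MetricSeq) (c : ℕ → Fin (n + 1) → Bool) : FullShift a :=
  fun i => c i 0

variable {c : ℕ → Fin (n + 1) → Bool} {p : ℕ}

theorem isPeriodicPt_walkPoint (hc : Function.Periodic c p) :
    Function.IsPeriodicPt (shift a) p (walkPoint a c) :=
  funext fun i => (shift_iterate_apply p _ i).trans (congrFun (hc i) 0)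

theorem word_shift_iterate_walkPoint (hc : IsWalk (V := Fin n → Bool) Fin.init Fin.tail c)
    (k : ℕ) : word n ((shift a)^[k] (walkPoint a c)) = c k := by
  have happly (j : ℕ) (hj : j < n + 1) (k : ℕ) : c (k + j) 0 = c k ⟨j, hj⟩ := by
    induction j generalizing k with
    | zero => rfl
    | succ j ih =>
      rw [← add_assoc, Nat.add_right_comm, ih (Nat.lt_of_succ_lt hj)]
      exact (congrFun (hc k) ⟨j, Nat.lt_of_succ_lt_succ hj⟩).symm
  funext j
  rw [word, shift_iterate_apply, add_comm]
  exact happly j j.2 k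

/-- A point in each cylinder of length `n + 1`, chosen on the orbit of `walkPoint a c` where this
orbit meets the cylinder. -/
noncomputable def orbitSection (a : MetricSeq) (c : ℕ → Fin (n + 1) → Bool) :
    (Fin (n + 1) → Bool) → FullShift a :=
  Function.extend c (fun i => (shift a)^[i] (walkPoint a c)) (pad a)

theorem orbitSection_apply (hc : IsSimpleCycle (V := Fin n → Bool) Fin.init Fin.tail c p) (i : ℕ) :
    orbitSection a c (c i) = (shift a)^[i] (walkPoint a c) := by
  refine Function.FactorsThrough.extend_apply (fun i j hij => funext fun m => ?_) _ i
  rw [shift_iterate_apply, shift_iterate_apply, add_comm m, add_comm m]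
  exact congrFun (hc.apply_add_eq hij m) 0

theorem word_orbitSection (hc : IsSimpleCycle (V := Fin n → Bool) Fin.init Fin.tail c p)
    (e : Fin (n + 1) → Bool) : word n (orbitSection a c e) = e := by
  by_cases he : ∃ i, c i = e
  · obtain ⟨i, rfl⟩ := he
    rw [orbitSection_apply hc, word_shift_iterate_walkPoint hc.walk]
  · rw [orbitSection, Function.extend_apply' _ _ _ he, word_pad]

theorem apply_eq_orbitSection_apply
    (hc : IsSimpleCycle (V := Fin n → Bool) Fin.init Fin.tail c p) {j : ℕ}
    (hx : ∀ k ≤ j, word n ((shift a)^[k] x) ∈ range c) {m : ℕ} (hm : m < n + 1 + j) :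
    x m = orbitSection a c (word n x) m := by
  obtain ⟨i, hi⟩ := hx 0 (Nat.zero_le j)
  have hword (k : ℕ) (hk : k ≤ j) :
      word n ((shift a)^[k] x) = word n ((shift a)^[i + k] (walkPoint a c)) := by
    rw [word_shift_iterate_walkPoint hc.walk]
    exact hc.walk_eq_of_mem_range (isWalk_word n x) hi.symm fun l hl => hx l (hl.trans hk)
  have hsymbol := congrFun (hword (min m j) (min_le_right m j)) ⟨m - min m j, by lia⟩
  simp only [word, shift_iterate_apply] at hsymbol
  rw [show word n x = c i from hi.symm, orbitSection_apply hc, shift_iterate_apply]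
  rwa [show m - min m j + min m j = m by lia, show m - min m j + (i + min m j) = m + i by lia]
    at hsymbol

theorem eq_orbitSection (hc : IsSimpleCycle (V := Fin n → Bool) Fin.init Fin.tail c p)
    (hx : ∀ k, word n ((shift a)^[k] x) ∈ range c) : x = orbitSection a c (word n x) :=
  funext fun m => apply_eq_orbitSection_apply hc (j := m) (fun k _ => hx k) (by lia)

theorem birkhoffSum_sub_orbitSection_le
    (hc : IsSimpleCycle (V := Fin n → Bool) Fin.init Fin.tail c p)
    (htail : ∀ j, ∑ k ∈ Finset.range j, a.toFun (n + 2 + k) ≤ 2 * a.toFun (n + 2))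
    (g : Lip (FullShift a)) (N : ℕ) (x : FullShift a) :
    birkhoffSum (shift a) (fun y => g y - g (orbitSection a c (word n y)) -
      (word n ⁻¹' range c)ᶜ.indicator (fun _ => 3 * ‖g‖ * a.toFun (n + 2)) y) N x ≤
      2 * ‖g‖ * a.toFun (n + 2) := by
  have hg {x y : FullShift a} {r : ℝ} (h : dist x y ≤ r) : g x - g y ≤ ‖g‖ * r :=
    (le_abs_self _).trans ((g.abs_sub_le x y).trans (by gcongr))
  refine birkhoffSum_le_of_exit (C := word n ⁻¹' range c) (b := fun j => ‖g‖ * a.toFun (n + 2 + j))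
    (fun j => ?_) (fun k => mul_nonneg (norm_nonneg g) (a.pos _).le) (fun x hx => ?_)
    (fun x j hx _ => ?_) (fun x hx => ?_) N x
  · rw [← Finset.mul_sum, mul_comm 2, mul_assoc]
    exact mul_le_mul_of_nonneg_left (htail j) (norm_nonneg g)
  · rw [indicator_of_mem hx]
    linarith [hg (dist_le_of_word_eq (word_orbitSection (a := a) hc (word n x)).symm)]
  · rw [indicator_of_notMem (not_not.2 (hx 0 j.zero_le)), sub_zero,
      show n + 2 + j = n + 1 + j + 1 by ring]
    exact hg (dist_le_of_forall_lt fun m => apply_eq_orbitSection_apply hc hx)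
  · rw [indicator_of_notMem (not_not.2 (hx 0)), sub_zero, ← eq_orbitSection hc hx, sub_self]

theorem exists_birkhoffSum_word_le {W : (Fin (n + 1) → Bool) → ℝ}
    {S : Finset (Fin (n + 1) → Bool)} {δ : ℝ} (hS : IsDominant (deBruijnCycles n) δ W S)
    (hδ : 0 ≤ δ) : ∃ K, ∀ N (x : FullShift a), birkhoffSum (shift a) (fun y =>
      W (word n y) - 𝔼 e ∈ S, W e + (word n ⁻¹' S)ᶜ.indicator (fun _ => δ) y) N x ≤ K := by
  classical
  refine ⟨_, fun N x => le_of_eq_of_le (Finset.sum_congr rfl fun i _ => ?_)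
    ((isWalk_word n x).sum_le (fun S' => hS.sum_le_zero hδ) N)⟩
  simp [indicator_apply, ite_not]

/-- Compare `g` with its value at the point of `orbitSection` in the same cylinder: the latter
depends only on the word, and its Birkhoff sums are controlled by the de Bruijn graph. -/
theorem isUniqueMaximizing_of_isDominant
    (hc : IsSimpleCycle (V := Fin n → Bool) Fin.init Fin.tail c p)
    {S : Finset (Fin (n + 1) → Bool)} (hSc : (S : Set (Fin (n + 1) → Bool)) = range c)
    (htail : ∀ j, ∑ k ∈ Finset.range j, a.toFun (n + 2 + k) ≤ 2 * a.toFun (n + 2))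
    {g : Lip (FullShift a)} {δ : ℝ} (hδ : 5 * ‖g‖ * a.toFun (n + 2) < δ)
    (hdom : IsDominant (deBruijnCycles n) δ (fun e => g (pad a e)) S) :
    IsUniqueMaximizing (shift a) g (orbitMeasure (shift a) p (walkPoint a c)) := by
  have hgA : 0 ≤ ‖g‖ * a.toFun (n + 2) := mul_nonneg (norm_nonneg g) (a.pos _).le
  have hdom' := hdom.of_abs_sub_le (W' := fun e => g (orbitSection a c e)) hgA fun e =>
    (g.abs_sub_le _ _).trans <| mul_le_mul_of_nonneg_left
      (dist_le_of_word_eq (by rw [word_orbitSection hc, word_pad])) (norm_nonneg g)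
  have hmean : 𝔼 e ∈ S, g (orbitSection a c e) =
      birkhoffAverage ℝ (shift a) g p (walkPoint a c) := by
    simp only [hc.expect_eq hSc, orbitSection_apply hc, birkhoffAverage, birkhoffSum, smul_eq_mul,
      div_eq_inv_mul]
  obtain ⟨K, hK⟩ := exists_birkhoffSum_word_le (a := a) hdom' (by linarith)
  rw [hmean, hSc] at hK
  refine isUniqueMaximizing_orbitMeasure measurable_shift g.continuous.measurable g.abs_apply_le
    hc.pos (isPeriodicPt_walkPoint hc.periodic) (C := word n ⁻¹' range c)
    ((isOpen_discrete _).preimage continuous_word).measurableSet (fun x hx => ?_)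
    (η := δ - 5 * ‖g‖ * a.toFun (n + 2)) (by linarith)
    (K := K + 2 * ‖g‖ * a.toFun (n + 2)) (fun N x => ?_)
  · obtain ⟨i, hi⟩ := hx 0
    exact ⟨i, (orbitSection_apply hc i).symm.trans
      ((congrArg _ hi).trans (eq_orbitSection hc hx).symm)⟩
  · refine le_of_eq_of_le ?_ (add_le_add (hK N x) (birkhoffSum_sub_orbitSection_le hc htail g N x))
    rw [← birkhoffSum_add']
    refine Finset.sum_congr rfl fun i _ => ?_
    by_cases hi : (shift a)^[i] x ∈ (word n ⁻¹' range c)ᶜ <;>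
      simp only [Pi.add_apply, indicator_of_mem, indicator_of_notMem, hi, not_false_iff] <;> ring

theorem mem_lock_of_isDominant {S : Finset (Fin (n + 1) → Bool)}
    (htail : ∀ j, ∑ k ∈ Finset.range j, a.toFun (n + 2 + k) ≤ 2 * a.toFun (n + 2))
    {f : Lip (FullShift a)} {δ : ℝ} (hδ : 5 * ‖f‖ * a.toFun (n + 2) < δ)
    (hdom : IsDominant (deBruijnCycles n) δ (fun e => f (pad a e)) S) : f ∈ Lock (shift a) := by
  obtain ⟨c, p, hc, hSc⟩ := hdom.mem
  have hnear : ∀ᶠ g : Lip (FullShift a) in 𝓝 f, IsUniqueMaximizing (shift a) g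
      (orbitMeasure (shift a) p (walkPoint a c)) := by
    have hmargin : Continuous fun g : Lip (FullShift a) =>
        5 * ‖g‖ * a.toFun (n + 2) + 2 * ‖g - f‖ := by fun_prop
    filter_upwards [hmargin.continuousAt.eventually_lt_const
      (show 5 * ‖f‖ * a.toFun (n + 2) + 2 * ‖f - f‖ < δ by simpa using hδ)] with g hg
    exact isUniqueMaximizing_of_isDominant hc hSc htail (by linarith)
      (hdom.of_abs_sub_le (norm_nonneg (g - f)) fun e => (g - f).abs_apply_le (pad a e))
  exact ⟨_, hnear.self_of_nhds, isSupportedOnPeriodicOrbit_orbitMeasure hc.pos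
    (isPeriodicPt_walkPoint hc.periodic), hnear⟩

end FullShift

/-! ### Random perturbations -/

section Resampling

variable {ι : Type*} [DecidableEq ι] {X : ι → Type*} [∀ i, MeasurableSpace (X i)]
  (μ : ∀ i, Measure (X i)) [∀ i, IsProbabilityMeasure (μ i)]

theorem map_update_infinitePi (j : ι) :
    ((Measure.infinitePi μ).prod (μ j)).map
      (fun z : (∀ i, X i) × X j => Function.update z.1 j z.2) = Measure.infinitePi μ := by
  refine Measure.eq_infinitePi μ fun s t ht => ?_
  have hpre : (fun z : (∀ i, X i) × X j => Function.update z.1 j z.2) ⁻¹' Set.pi s t =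
      Set.pi (s.erase j) t ×ˢ {x | j ∈ s → x ∈ t j} := by
    ext z
    rw [mem_preimage, update_mem_pi_iff, Finset.coe_erase]
    rfl
  rw [Measure.map_apply measurable_update' (.pi s.countable_toSet fun i _ => ht i), hpre,
    Measure.prod_prod, Measure.infinitePi_pi _ fun i _ => ht i]
  by_cases hj : j ∈ s
  · simpa [hj] using Finset.prod_erase_mul s (fun i => μ i (t i)) hj
  · simp [hj]

theorem infinitePi_le_of_forall_update_le {j : ι} {A : Set (∀ i, X i)} (hA : MeasurableSet A)
    {ε : ENNReal} (h : ∀ ω, μ j {x | Function.update ω j x ∈ A} ≤ ε) :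
    Measure.infinitePi μ A ≤ ε := by
  rw [← map_update_infinitePi μ j, Measure.map_apply measurable_update' hA,
    Measure.prod_apply (measurable_update' hA)]
  exact (lintegral_mono h).trans_eq (by simp)

end Resampling

theorem volume_le_of_forall_abs_sub_le {S : Set unitInterval} {r : ℝ}
    (h : ∀ x ∈ S, ∀ y ∈ S, |(x : ℝ) - y| ≤ r) : volume S ≤ ENNReal.ofReal r := by
  rw [unitInterval.volume_apply]
  refine (Real.volume_le_diam _).trans (Metric.ediam_le ?_)
  rintro _ ⟨x, hx, rfl⟩ _ ⟨y, hy, rfl⟩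
  rw [edist_dist]
  exact ENNReal.ofReal_le_ofReal (h x hx y hy)

namespace IsPrevalent

variable {V : Type*} [AddCommGroup V] [TopologicalSpace V] [MeasurableSpace V] {S S' : Set V}

theorem mono (h : IsPrevalent S) (hS : S ⊆ S') : IsPrevalent S' := by
  obtain ⟨B, hB, hSB⟩ := h
  exact ⟨B, hB, (compl_subset_compl.2 hS).trans hSB⟩

theorem of_forall_ae [BorelSpace V] [T2Space V] [ContinuousAdd V] {Ω : Type*} [TopologicalSpace Ω]
    [CompactSpace Ω] [MeasurableSpace Ω] [OpensMeasurableSpace Ω] {P : Measure Ω}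
    [IsProbabilityMeasure P] {φ : Ω → V} (hφ : Continuous φ) (hS : MeasurableSet S)
    (h : ∀ v, ∀ᵐ ω ∂P, φ ω + v ∈ S) : IsPrevalent S := by
  have hrange := isCompact_range hφ
  refine ⟨Sᶜ, ⟨hS.compl, P.map φ, Measure.isProbabilityMeasure_map hφ.measurable.aemeasurable,
    ⟨range φ, hrange, ?_⟩, fun v => ?_⟩, subset_rfl⟩
  · rw [Measure.map_apply hφ.measurable hrange.measurableSet.compl]
    simp [preimage_compl]
  · rw [image_add_right, Measure.map_apply hφ.measurable
      ((continuous_add_const (-v)).measurable hS.compl)]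
    exact h (-v)

end IsPrevalent

theorem exists_summable_tendsto_div {b : ℕ → ℝ} (hb : Tendsto b atTop (𝓝 0)) :
    ∃ c : ℕ → ℝ, (∀ n, 0 < c n) ∧ Summable c ∧
      ∃ φ : ℕ → ℕ, StrictMono φ ∧ Tendsto (fun k => b (φ k) / c (φ k)) atTop (𝓝 0) := by
  have hhalf (k : ℕ) : (0 : ℝ) < (1 / 2) ^ k := by positivity
  obtain ⟨φ, hφ, hbφ⟩ := extraction_forall_of_eventually fun k =>
    hb.norm.eventually_le_const (norm_zero.trans_lt (mul_pos (hhalf k) (hhalf k)))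
  set u : ℕ → ℝ := Function.extend φ (fun k => (1 / 2) ^ k) 0
  have huφ (k : ℕ) : u (φ k) = (1 / 2) ^ k := hφ.injective.extend_apply _ _ k
  have hu0 : 0 ≤ u := Function.extend_nonneg (fun k => (hhalf k).le) le_rfl
  have husum : Summable u := (summable_extend_zero hφ.injective).2 summable_geometric_two
  refine ⟨fun n => (1 / 2) ^ n + u n, fun n => add_pos_of_pos_of_nonneg (hhalf n) (hu0 n),
    summable_geometric_two.add husum, φ, hφ, squeeze_zero_norm (fun k => ?_)
      (tendsto_pow_atTop_nhds_zero_of_lt_one one_half_pos.le one_half_lt_one)⟩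
  have hc : (1 / 2) ^ k ≤ (1 / 2) ^ φ k + u (φ k) :=
    huφ k ▸ le_add_of_nonneg_left (hhalf (φ k)).le
  refine (norm_div _ _).trans_le <| div_le_of_le_mul₀ (norm_nonneg _) (hhalf k).le <|
    (hbφ k).trans ?_
  exact mul_le_mul_of_nonneg_left (hc.trans (le_abs_self _)) (hhalf k).le

namespace FullShift

/-- The nonempty words; they index the coefficients of a random sum of cylinder functions. -/
abbrev Words : Type := Σ n : ℕ, (Fin (n + 1) → Bool)

variable {a : MetricSeq} {n : ℕ}

theorem le_dist_of_word_ne {x y : FullShift a} (h : word n x ≠ word n y) :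
    a.toFun (n + 1) ≤ dist x y := by
  by_contra! hlt
  exact h (funext fun i => (dist_lt_iff (n + 1)).1 hlt i i.2)

section CylinderSeries

variable {H : Words → ℝ} {D : ℕ → ℝ} {f : FullShift a → ℝ}

theorem norm_cylinder_term_le (hH : ∀ n e, |H ⟨n, e⟩| ≤ D n) (x : FullShift a) (n : ℕ) :
    ‖a.toFun (n + 1) * H ⟨n, word n x⟩‖ ≤ a.toFun 0 * D n := by
  rw [norm_mul, Real.norm_of_nonneg (a.pos _).le]
  exact mul_le_mul (a.strictAnti.antitone (Nat.zero_le _)) (hH n _) (norm_nonneg _) (a.pos 0).le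

/-- Words of length `n + 1` of two sequences differ only if their distance is at least
`a (n + 1)`: this is why this factor makes the series Lipschitz. -/
theorem abs_sub_le_of_hasSum (hH : ∀ n e, |H ⟨n, e⟩| ≤ D n) (hD : Summable D)
    (hf : ∀ x, HasSum (fun n => a.toFun (n + 1) * H ⟨n, word n x⟩) (f x)) (x y : FullShift a) :
    |f x - f y| ≤ 2 * (∑' n, D n) * dist x y := by
  rw [mul_assoc, ← tsum_mul_right, ← tsum_mul_left]
  refine ((hf x).sub (hf y)).norm_le_of_bounded ((hD.mul_right _).mul_left _).hasSum fun n => ?_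
  rw [← mul_sub, norm_mul, Real.norm_of_nonneg (a.pos _).le]
  rcases eq_or_ne (word n x) (word n y) with hw | hw
  · have hD0 : 0 ≤ D n := (abs_nonneg _).trans (hH n (word n x))
    rw [hw, sub_self, norm_zero, mul_zero]
    positivity
  · have hdiff : ‖H ⟨n, word n x⟩ - H ⟨n, word n y⟩‖ ≤ 2 * D n := by
      refine (norm_sub_le _ _).trans ?_
      linarith [hH n (word n x), hH n (word n y), Real.norm_eq_abs (H ⟨n, word n x⟩),
        Real.norm_eq_abs (H ⟨n, word n y⟩)]
    calc a.toFun (n + 1) * ‖H ⟨n, word n x⟩ - H ⟨n, word n y⟩‖ ≤ dist x y * (2 * D n) :=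
          mul_le_mul (le_dist_of_word_ne hw) hdiff (norm_nonneg _) dist_nonneg
      _ = 2 * (D n * dist x y) := by ring

theorem norm_le_of_hasSum {f : Lip (FullShift a)} (hH : ∀ n e, |H ⟨n, e⟩| ≤ D n)
    (hD : Summable D) (hf : ∀ x, HasSum (fun n => a.toFun (n + 1) * H ⟨n, word n x⟩) (f x)) :
    ‖f‖ ≤ (a.toFun 0 + 2) * ∑' n, D n := by
  have hD0 : 0 ≤ ∑' n, D n := tsum_nonneg fun n => (abs_nonneg _).trans (hH n fun _ => false)
  rw [add_mul]
  refine Lip.norm_le_add (mul_nonneg (a.pos 0).le hD0) (mul_nonneg zero_le_two hD0) (fun x => ?_)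
    (abs_sub_le_of_hasSum hH hD hf)
  rw [← tsum_mul_left]
  exact (hf x).norm_le_of_bounded (hD.mul_left _).hasSum (norm_cylinder_term_le hH x)

end CylinderSeries

variable {c : ℕ → ℝ}

theorem abs_mul_coe_unitInterval_le {r : ℝ} (hr : 0 ≤ r) (t : unitInterval) : |r * t| ≤ r := by
  rw [abs_of_nonneg (mul_nonneg hr t.2.1)]
  exact mul_le_of_le_one_right hr t.2.2

theorem summable_noise (a : MetricSeq) (hc0 : ∀ n, 0 ≤ c n) (hc : Summable c)
    (ω : Words → unitInterval) (x : FullShift a) :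
    Summable fun n => a.toFun (n + 1) * (c n * ω ⟨n, word n x⟩) :=
  .of_norm_bounded (hc.mul_left _) <| norm_cylinder_term_le (H := fun w => c w.1 * ω w)
    (fun n _ => abs_mul_coe_unitInterval_le (hc0 n) _) x

/-- The random perturbation: a sum of multiples of the indicator functions of all cylinders. The
cylinders of length `n + 1` have the coefficients `a (n + 1) * c n * ω`, where the factor
`a (n + 1)` is the distance of such a cylinder to its complement. -/
noncomputable def noise (a : MetricSeq) (hc0 : ∀ n, 0 ≤ c n) (hc : Summable c)
    (ω : Words → unitInterval) : Lip (FullShift a) :=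
  ⟨fun x => ∑' n, a.toFun (n + 1) * (c n * ω ⟨n, word n x⟩), Real.toNNReal (2 * ∑' n, c n),
    .of_dist_le' <| abs_sub_le_of_hasSum (H := fun w => c w.1 * ω w)
      (fun n _ => abs_mul_coe_unitInterval_le (hc0 n) _) hc
      fun x => (summable_noise a hc0 hc ω x).hasSum⟩

theorem norm_mul_dist_le (hc0 : ∀ n, 0 ≤ c n) (ω ω' : Words → unitInterval) (n : ℕ) :
    ‖c n * dist (fun e => ω ⟨n, e⟩) (fun e => ω' ⟨n, e⟩)‖ ≤ c n := by
  rw [Real.norm_of_nonneg (mul_nonneg (hc0 n) dist_nonneg)]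
  refine mul_le_of_le_one_right (hc0 n) ((dist_pi_le_iff zero_le_one).2 fun e => ?_)
  exact Real.dist_le_of_mem_Icc_01 (ω _).2 (ω' _).2

section Noise

variable (hc0 : ∀ n, 0 ≤ c n) (hc : Summable c)

theorem hasSum_noise (ω : Words → unitInterval) (x : FullShift a) :
    HasSum (fun n => a.toFun (n + 1) * (c n * ω ⟨n, word n x⟩)) (noise a hc0 hc ω x) :=
  (summable_noise a hc0 hc ω x).hasSum

theorem hasSum_noise_sub (ω ω' : Words → unitInterval) (x : FullShift a) :
    HasSum (fun n => a.toFun (n + 1) * (c n * (ω ⟨n, word n x⟩ - ω' ⟨n, word n x⟩)))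
      (noise a hc0 hc ω x - noise a hc0 hc ω' x) := by
  simpa only [mul_sub] using (hasSum_noise hc0 hc ω x).sub (hasSum_noise hc0 hc ω' x)

theorem noise_sub_eq_of_agree {ω ω' : Words → unitInterval}
    (h : ∀ m ≠ n, ∀ e, ω ⟨m, e⟩ = ω' ⟨m, e⟩) (x : FullShift a) :
    noise a hc0 hc ω x - noise a hc0 hc ω' x =
      a.toFun (n + 1) * (c n * (ω ⟨n, word n x⟩ - ω' ⟨n, word n x⟩)) :=
  (hasSum_noise_sub hc0 hc ω ω' x).unique <| hasSum_single n fun m hm => by simp [h m hm]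

theorem norm_noise_sub_le (ω ω' : Words → unitInterval) :
    ‖noise a hc0 hc ω - noise a hc0 hc ω'‖ ≤
      (a.toFun 0 + 2) * ∑' n, c n * dist (fun e => ω ⟨n, e⟩) (fun e => ω' ⟨n, e⟩) := by
  refine norm_le_of_hasSum (H := fun w => c w.1 * (ω w - ω' w)) (fun n e => ?_)
    (.of_norm_bounded hc (norm_mul_dist_le hc0 ω ω')) (hasSum_noise_sub hc0 hc ω ω')
  rw [abs_mul, abs_of_nonneg (hc0 n)]
  exact mul_le_mul_of_nonneg_left (dist_le_pi_dist (fun e => ω ⟨n, e⟩) (fun e => ω' ⟨n, e⟩) e)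
    (hc0 n)

theorem continuous_noise : Continuous (noise a hc0 hc) := by
  refine continuous_iff_continuousAt.2 fun ω' => tendsto_iff_norm_sub_tendsto_zero.2 ?_
  have hbound : Continuous fun ω : Words → unitInterval => (a.toFun 0 + 2) *
      ∑' n, c n * dist (fun e => ω ⟨n, e⟩) (fun e => ω' ⟨n, e⟩) :=
    continuous_const.mul <| continuous_tsum (fun n => by fun_prop) hc
      fun n ω => norm_mul_dist_le hc0 ω ω' n
  exact squeeze_zero (fun _ => norm_nonneg _) (fun ω => norm_noise_sub_le hc0 hc ω ω')
    (by simpa using hbound.tendsto ω')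

/-- The distribution of the coefficients of `noise`: independent and uniform. -/
noncomputable def noiseMeasure : Measure (Words → unitInterval) :=
  Measure.infinitePi fun _ => volume

instance : IsProbabilityMeasure noiseMeasure :=
  inferInstanceAs (IsProbabilityMeasure (Measure.infinitePi fun _ => volume))

theorem measurableSet_isNearTie_noise (Z : Set (Finset (Fin (n + 1) → Bool))) (δ : ℝ)
    (e : Fin (n + 1) → Bool) (f : Lip (FullShift a)) :
    MeasurableSet {ω | IsNearTie Z δ e fun e' => (noise a hc0 hc ω + f) (pad a e')} := by
  refine ((isClosed_isNearTie Z δ e).preimage (continuous_pi fun e' => ?_)).measurableSet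
  exact (Lip.continuous_eval _).comp ((continuous_noise hc0 hc).add continuous_const)

theorem noiseMeasure_isNearTie_le {Z : Set (Finset (Fin (n + 1) → Bool))} {N : ℕ}
    (hN : ∀ S ∈ Z, S.card ≤ N) (hcn : 0 < c n) (δ : ℝ) (e : Fin (n + 1) → Bool)
    (f : Lip (FullShift a)) :
    noiseMeasure {ω | IsNearTie Z δ e fun e' => (noise a hc0 hc ω + f) (pad a e')} ≤
      ENNReal.ofReal (N * δ / (a.toFun (n + 1) * c n)) := by
  classical
  refine infinitePi_le_of_forall_update_le _ (j := ⟨n, e⟩)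
    (measurableSet_isNearTie_noise hc0 hc Z δ e f) fun ω =>
      volume_le_of_forall_abs_sub_le fun t ht t' ht' => ?_
  have hsub (e' : Fin (n + 1) → Bool) := noise_sub_eq_of_agree (a := a) (n := n) hc0 hc
    (ω := Function.update ω ⟨n, e⟩ t) (ω' := Function.update ω ⟨n, e⟩ t')
    (fun m hm e' => by simp [Function.update_of_ne, hm]) (pad a e')
  have hspread := IsNearTie.abs_sub_le hN ht' ht fun e' he' => by
    have hne : (⟨n, e'⟩ : Words) ≠ ⟨n, e⟩ := by simpa using he'
    have heq := hsub e'
    rw [word_pad, Function.update_of_ne hne, Function.update_of_ne hne, sub_self, mul_zero,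
      mul_zero, sub_eq_zero] at heq
    simp only [Lip.add_apply, heq]
  have hself := hsub e
  rw [word_pad, Function.update_self, Function.update_self] at hself
  rw [le_div_iff₀ (mul_pos (a.pos _) hcn)]
  simp only [Lip.add_apply, add_sub_add_right_eq_sub, hself] at hspread
  rwa [abs_mul, abs_mul, abs_of_pos (a.pos _), abs_of_pos hcn, ← mul_assoc, mul_comm] at hspread

theorem exists_isNearTie_of_notMem_lock
    (htail : ∀ j, ∑ k ∈ Finset.range j, a.toFun (n + 2 + k) ≤ 2 * a.toFun (n + 2))
    {f : Lip (FullShift a)} {δ : ℝ} (hδ : 5 * ‖f‖ * a.toFun (n + 2) < δ)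
    (hf : f ∉ Lock (shift a)) :
    ∃ e, IsNearTie (deBruijnCycles n) δ e fun e' => f (pad a e') := by
  by_contra! hno
  obtain ⟨S, hS⟩ := exists_isDominant (isAntichain_simpleCycles _ _) (deBruijnCycles_nonempty n) hno
  exact hf (mem_lock_of_isDominant htail hδ hS)

theorem noiseMeasure_notMem_lock_le (hcn : 0 < c n)
    (htail : ∀ j, ∑ k ∈ Finset.range j, a.toFun (n + 2 + k) ≤ 2 * a.toFun (n + 2))
    {f : Lip (FullShift a)} {L : ℝ} (hL : ∀ ω, ‖noise a hc0 hc ω + f‖ < L) :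
    noiseMeasure {ω | noise a hc0 hc ω + f ∉ Lock (shift a)} ≤
      ENNReal.ofReal
        (5 / 2 * L * (a.toFun (n + 2) / a.toFun (n + 1) / (1 / 4) ^ (n + 1) / c n)) := by
  set δ := 5 * L * a.toFun (n + 2)
  set r := ((2 ^ n : ℕ) : ℝ) * δ / (a.toFun (n + 1) * c n)
  have hcard : ∀ S ∈ deBruijnCycles n, S.card ≤ 2 ^ n := fun S hS => by
    simpa using card_le_of_mem_simpleCycles hS
  have hδ (ω) : 5 * ‖noise a hc0 hc ω + f‖ * a.toFun (n + 2) < δ :=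
    mul_lt_mul_of_pos_right (by linarith [hL ω]) (a.pos _)
  calc noiseMeasure {ω | noise a hc0 hc ω + f ∉ Lock (shift a)}
      ≤ noiseMeasure (⋃ e, {ω | IsNearTie (deBruijnCycles n) δ e
          fun e' => (noise a hc0 hc ω + f) (pad a e')}) :=
        measure_mono fun ω hω => mem_iUnion.2 (exists_isNearTie_of_notMem_lock htail (hδ ω) hω)
    _ ≤ ∑ _e : Fin (n + 1) → Bool, ENNReal.ofReal r :=
        (measure_iUnion_fintype_le _ _).trans <| Finset.sum_le_sum fun e _ =>
          noiseMeasure_isNearTie_le hc0 hc hcard hcn δ e f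
    _ = ENNReal.ofReal (2 ^ (n + 1) * r) := by
        rw [ENNReal.ofReal_mul (by positivity)]
        simp
    _ = _ := by
        congr 1
        have hpow : (4 : ℝ) ^ (n + 1) = 4 * (2 ^ n * 2 ^ n) := by
          rw [← mul_pow, pow_succ']
          norm_num
        have ha := (a.pos (n + 1)).ne'
        simp only [r, δ]
        push_cast
        rw [div_pow, one_pow, hpow]
        field_simp
        ring

theorem ae_noise_add_mem_lock (hcpos : ∀ n, 0 < c n) {φ : ℕ → ℕ} (hφ : Tendsto φ atTop atTop)
    (hlim : Tendsto (fun k => a.toFun (φ k + 2) / a.toFun (φ k + 1) / (1 / 4) ^ (φ k + 1) /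
      c (φ k)) atTop (𝓝 0))
    (htail : ∀ᶠ n in atTop, ∀ j, ∑ k ∈ Finset.range j, a.toFun (n + 2 + k) ≤ 2 * a.toFun (n + 2))
    (f : Lip (FullShift a)) :
    ∀ᵐ ω ∂noiseMeasure, noise a (fun n => (hcpos n).le) hc ω + f ∈ Lock (shift a) := by
  obtain ⟨L, hL⟩ := (isCompact_range (f := fun ω => ‖noise a (fun n => (hcpos n).le) hc ω + f‖)
    ((continuous_noise _ hc).add continuous_const).norm).bddAbove
  rw [mem_upperBounds, forall_mem_range] at hL
  have hzero : Tendsto (fun k => ENNReal.ofReal (5 / 2 * (L + 1) * (a.toFun (φ k + 2) /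
      a.toFun (φ k + 1) / (1 / 4) ^ (φ k + 1) / c (φ k)))) atTop (𝓝 0) := by
    simpa using ENNReal.tendsto_ofReal (hlim.const_mul (5 / 2 * (L + 1)))
  refine le_antisymm (ge_of_tendsto hzero ?_) bot_le
  filter_upwards [hφ.eventually htail] with k hk
  exact noiseMeasure_notMem_lock_le _ hc (hcpos _) hk fun ω => (hL ω).trans_lt (lt_add_one L)

end Noise

theorem eventually_sum_range_le_two_mul
    (hratio : Tendsto (fun n => a.toFun (n + 1) / a.toFun n) atTop (𝓝 0)) :
    ∀ᶠ n in atTop, ∀ j, ∑ k ∈ Finset.range j, a.toFun (n + k) ≤ 2 * a.toFun n := by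
  obtain ⟨N, hN⟩ := eventually_atTop.1 (hratio.eventually_le_const one_half_pos)
  filter_upwards [eventually_ge_atTop N] with n hn
  refine sum_range_le_two_mul (fun k => (a.pos _).le) fun k => ?_
  have hk := hN (n + k) (hn.trans (Nat.le_add_right n k))
  rw [div_le_iff₀ (a.pos _)] at hk
  rw [← add_assoc]
  linarith

theorem isPrevalent_lock
    (hdecay : (fun n => a.toFun (n + 1) / a.toFun n) =o[atTop] fun n => (1 / 4 : ℝ) ^ n) :
    IsPrevalent (Lock (shift a)) := by
  obtain ⟨c, hcpos, hc, φ, hφ, hlim⟩ := exists_summable_tendsto_div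
    ((tendsto_add_atTop_iff_nat 1).2 hdecay.tendsto_div_nhds_zero)
  have htail := eventually_sum_range_le_two_mul (hdecay.trans_tendsto
    (tendsto_pow_atTop_nhds_zero_of_lt_one (by norm_num) (by norm_num)))
  exact .of_forall_ae (continuous_noise _ hc) (isOpen_lock _).measurableSet <|
    ae_noise_add_mem_lock hc hcpos hφ.tendsto_atTop hlim
      ((tendsto_add_atTop_nat 2).eventually htail)

end FullShift

theorem theorem1p1_general (a : MetricSeq)
    (hdecay : (fun n => a.toFun (n + 1) / a.toFun n) =o[atTop] fun n => (1 / 4 : ℝ) ^ n) :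
    IsPrevalent {f : Lip (FullShift a) | f.toContinuousMap ∈ PU (FullShift.shift a)} ∧
      IsPrevalent (Lock (FullShift.shift a)) := by
  have h := FullShift.isPrevalent_lock hdecay
  exact ⟨h.mono fun f ⟨ν, hν, hper, _⟩ => ⟨ν, hν, hper⟩, h⟩

theorem theorem1p1 (θ : ℝ) (hθ : θ ∈ Set.Ioo (0 : ℝ) (1 / 4))
    (a : ℕ → ℝ) (ha : StrictAnti a) (hpos : ∀ n, 0 < a n)
    (hdecay : (fun n : ℕ => a (n + 1) / a n) =O[Filter.atTop] (fun n : ℕ => θ ^ n)) :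
    IsPrevalent {f : Lip (FullShift (MetricSeq.ofDecay a ha hpos hθ hdecay)) |
        f.toContinuousMap ∈ PU (FullShift.shift (MetricSeq.ofDecay a ha hpos hθ hdecay))} ∧
      IsPrevalent (Lock (FullShift.shift (MetricSeq.ofDecay a ha hpos hθ hdecay))) :=
  theorem1p1_general _ (hdecay.trans_isLittleO (isLittleO_pow_pow_of_lt_left hθ.1.le hθ.2))
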